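/- Let $L$ be a number field, let $j_0\in L\setminus\{0,1728\}$, and put $z_0=1-1728/j_0$. Fix a square root $\sqrt{z_0}$ of $z_0$, and consider the elliptic curves $$E_0/L:\ y^2=x^3-\frac{1}{48z_0^3}x+\frac{1}{864z_0^4},\qquad E_1/L(\sqrt{z_0}):\ y^2+xy=x^3-\frac{1-\sqrt{z_0}}{864}.$$ For a number field $K$ and a prime (nonzero prime ideal) $\mathfrak q$ of $K$, let $v_{\mathfrak q}$ be the $\mathfrak q$-adic valuation, $\mathbb F_{\mathfrak q}$ the residue field and $\mathrm N(\mathfrak q)=|\mathbb F_{\mathfrak q}|$. For $a\in K$ with $v_{\mathfrak q}(a)\ge 0$, let $\left(\frac{a}{\mathfrak q}\right)$ be $1$, $-1$ or $0$ according as $a$ is a nonzero square, a non-square, or zero in $\mathbb F_{\mathfrak q}$. For an elliptic curve $E/K$ with good reduction at $\mathfrak q$, let $a_{\mathfrak q}(E)=\mathrm N(\mathfrak q)+1-|E(\mathbb F_{\mathfrak q})|$, where $E(\mathbb F_{\mathfrak q})$ is the set of $\mathbb F_{\mathfrak q}$-points of the reduction of $E$ at $\mathfrak q$. Let $\mathfrak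 p$ be a prime of $L$ with $\mathfrak p\nmid 6$ and $v_{\mathfrak p}(j_0(j_0-1728))=0$, let $\mathfrak P$ be a prime of $L(\sqrt{z_0})$ lying above $\mathfrak p$, and let $p$ be the rational prime below $\mathfrak p$. Then $E_0$ has good reduction at $\mathfrak p$, $E_1$ has good reduction at $\mathfrak P$, and $$a_{\mathfrak p}(E_0)^2\equiv\begin{cases}a_{\mathfrak P}(E_1)^2&\text{if }\left(\frac{z_0}{\mathfrak p}\right)=1,\\[2pt]-\left(\frac{-1}{\mathfrak p}\right)a_{\mathfrak P}(E_1)&\text{if }\left(\frac{z_0}{\mathfrak p}\right)=-1\end{cases}\pmod p.$$ -/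

import Mathlib

open NumberField IsDedekindDomain

namespace TraceCongruence

section Local

variable {L : Type*} [Field L] [NumberField L]

/-- The valuation ring of `L` at the prime `𝔭`: all `a` in `L` with `v_𝔭(a) ≥ 0`
(the multiplicative valuation of Mathlib satisfies `𝔭.valuation L a ≤ 1`). -/
noncomputable abbrev localRing (𝔭 : HeightOneSpectrum (𝓞 L)) : Subring L :=
  (𝔭.valuation L).integer

/-- The residue field `𝔽_𝔭` of `L` at `𝔭`. -/
noncomputable abbrev resField (𝔭 : HeightOneSpectrum (𝓞 L)) : Type _ :=
  IsLocalRing.ResidueField (localRing 𝔭)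

open Classical in
/-- The quadratic residue symbol `(a / 𝔭)` of an element `a` of `L` with `v_𝔭(a) ≥ 0`:
it is `0` if `a = 0` in `𝔽_𝔭`, it is `1` if `a` is a nonzero square in `𝔽_𝔭`, and `-1` otherwise.
(For `v_𝔭(a) < 0` the symbol is not defined; the value here is `0`.) -/
noncomputable def quadSymbol (𝔭 : HeightOneSpectrum (𝓞 L)) (a : L) : ℤ :=
  if h : a ∈ localRing 𝔭 then
    if IsLocalRing.residue (localRing 𝔭) ⟨a, h⟩ = 0 then 0
    else if IsSquare (IsLocalRing.residue (localRing 𝔭) ⟨a, h⟩) then 1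
    else -1
  else 0

/-- `𝔭` is a good prime of the elliptic curve given by the Weierstrass equation `E` over `L`:
a minimal Weierstrass equation of `E` at `𝔭` has a discriminant that is a unit at `𝔭`. -/
def IsGoodPrime (E : WeierstrassCurve L) (𝔭 : HeightOneSpectrum (𝓞 L)) : Prop :=
  (E.minimal (localRing 𝔭)).HasGoodReduction (localRing 𝔭)

/-- `a_𝔭(E) = N(𝔭) + 1 - |E(𝔽_𝔭)|`, where `E(𝔽_𝔭)` is the set of points over `𝔽_𝔭`
(the point at infinity included) of the reduction at `𝔭` of a minimal equation of `E` at `𝔭`. -/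
noncomputable def trace (E : WeierstrassCurve L) (𝔭 : HeightOneSpectrum (𝓞 L)) : ℤ :=
  (Ideal.absNorm 𝔭.asIdeal : ℤ) + 1 -
    (Nat.card ((E.minimal (localRing 𝔭)).reduction (localRing 𝔭)).toAffine.Point : ℤ)

end Local

section Curves

variable {K : Type*} [Field K]

/-- `z₀ = 1 - 1728 / j₀`. -/
def zZero (j₀ : K) : K := 1 - 1728 / j₀

/-- The curve `E₀ : y² = x³ - x / (48 z³) + 1 / (864 z⁴)`, used with `z = z₀`. -/
def curveE₀ (z : K) : WeierstrassCurve K where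
  a₁ := 0
  a₂ := 0
  a₃ := 0
  a₄ := -(1 / (48 * z ^ 3))
  a₆ := 1 / (864 * z ^ 4)

/-- The curve `E₁ : y² + x y = x³ - (1 - s) / 864`, used with `s = √z₀`. -/
def curveE₁ (s : K) : WeierstrassCurve K where
  a₁ := 1
  a₂ := 0
  a₃ := 0
  a₄ := 0
  a₆ := -((1 - s) / 864)

end Curves

end TraceCongruence

/-! In a residue field with `q` elements and characteristic at least 5, Euler's criterion turns the
point count into a character sum: the trace equals `-cubicCharSum c₄ c₆`. This sum depends only on
`(c₄, c₆)`, so passing to a minimal equation merely rescales the pair by `(u⁴, u⁶)` with `u` a unit.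

The invariants are `(z⁻³, -z⁻⁴)` for E₀ and `(1, -s)` for E₁, where `s² = z`. With `d = s⁻³`, the
first pair is `(d² · 1, d³ · (-s))`, so over the residue field at 𝔓 the curve E₀ is the quadratic
twist of E₁ by `s`, and the two sums differ by the sign `χ(s)` (`cubicCharSum_eq_sqrt_pow_mul`).

If `z` is a square mod 𝔭, the residue fields coincide and squaring removes the sign. If not, the
extension is quadratic and the sum for E₀ upstairs is minus the square of the one downstairs
(`cubicCharSum_map_of_card_eq_sq`, the mod `p` shadow of `a_{q²} = a_q² - 2q`). There `χ(s) =
-χ(-1)`, with `χ(-1)` taken downstairs (`sqrt_pow_half_card_of_not_isSquare`), which gives the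
linear congruence. -/

namespace TraceCongruence

/-! ### Point counts and the Hasse invariant over a finite field -/

section FiniteField

open Polynomial

variable {k : Type*} [Field k]

lemma ringChar_ne_two_of_six_ne_zero (h6 : (6 : k) ≠ 0) : ringChar k ≠ 2 := by
  intro h
  apply h6
  have : ((2 : ℕ) : k) = 0 := by rw [← h]; exact ringChar.Nat.cast_ringChar
  have h2 : (2 : k) = 0 := by exact_mod_cast this
  linear_combination 3 * h2

variable [Fintype k]

/-- The sum over `x ∈ k` of the quadratic character of `x³ - 27 A x - 54 B`, as an element of `k`,
computed by Euler's criterion. -/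
def cubicCharSum (A B : k) : k :=
  ∑ x : k, (x ^ 3 - 27 * A * x - 54 * B) ^ (Fintype.card k / 2)

lemma card_eq_two_mul_half_add_one (h : ringChar k ≠ 2) :
    Fintype.card k = 2 * (Fintype.card k / 2) + 1 := by
  have := FiniteField.odd_card_of_char_ne_two h
  omega

lemma pow_half_card_sq (h : ringChar k ≠ 2) {d : k} (hd : d ≠ 0) :
    (d ^ (Fintype.card k / 2)) ^ 2 = 1 := by
  rw [← pow_mul]
  have := FiniteField.pow_card_sub_one_eq_one d hd
  rwa [show Fintype.card k - 1 = Fintype.card k / 2 * 2 by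
    have := card_eq_two_mul_half_add_one h; omega] at this

open Classical in
/-- Completing the square in a Weierstrass equation. -/
lemma card_equation_fiber (h : ringChar k ≠ 2) (W : WeierstrassCurve k) (x : k) :
    ((Fintype.card {y : k // W.toAffine.Equation x y} : ℕ) : k) =
      (4 * x ^ 3 + W.b₂ * x ^ 2 + 2 * W.b₄ * x + W.b₆) ^ (Fintype.card k / 2) + 1 := by
  set D := 4 * x ^ 3 + W.b₂ * x ^ 2 + 2 * W.b₄ * x + W.b₆ with hD
  have h2 : (2 : k) ≠ 0 := Ring.two_ne_zero h
  have hsq := congrArg (Int.cast : ℤ → k) (quadraticChar_card_sqrts h D)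
  push_cast at hsq
  rw [quadraticChar_eq_pow_of_char_ne_two' h] at hsq
  rw [← hsq, Set.toFinset_card]
  congr 1
  refine Fintype.card_congr
    { toFun := fun y => ⟨2 * y + W.a₁ * x + W.a₃, ?_⟩
      invFun := fun y => ⟨(y - W.a₁ * x - W.a₃) / 2, ?_⟩
      left_inv := fun y => by ext; field_simp; ring
      right_inv := fun y => by ext; field_simp; ring }
  · have := (WeierstrassCurve.Affine.equation_iff _ _).1 y.2
    simp only [Set.mem_ofPred_eq, hD, WeierstrassCurve.b₂, WeierstrassCurve.b₄,
      WeierstrassCurve.b₆]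
    linear_combination 4 * this
  · have := y.2
    simp only [Set.mem_ofPred_eq, hD, WeierstrassCurve.b₂, WeierstrassCurve.b₄,
      WeierstrassCurve.b₆] at this
    rw [WeierstrassCurve.Affine.equation_iff]
    field_simp
    linear_combination this

lemma card_point_eq_sum (h : ringChar k ≠ 2) (W : WeierstrassCurve k) (hΔ : W.Δ ≠ 0) :
    ((Nat.card W.toAffine.Point : ℕ) : k) =
      1 + ∑ x : k, (4 * x ^ 3 + W.b₂ * x ^ 2 + 2 * W.b₄ * x + W.b₆) ^ (Fintype.card k / 2) := by
  classical
  let e : W.toAffine.Point ≃ Option (Σ x : k, {y : k // W.toAffine.Equation x y}) :=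
    { toFun := fun P => match P with
        | .zero => none
        | .some x y h => some ⟨x, y, h.1⟩
      invFun := fun P => match P with
        | none => .zero
        | some ⟨x, y, h⟩ => .some x y
            ((WeierstrassCurve.Affine.equation_iff_nonsingular_of_Δ_ne_zero hΔ).1 h)
      left_inv := fun P => by cases P <;> rfl
      right_inv := fun P => by rcases P with _ | ⟨x, y, h⟩ <;> rfl }
  rw [Nat.card_congr e, Nat.card_eq_fintype_card, Fintype.card_option, Fintype.card_sigma]
  push_cast
  rw [Finset.sum_congr rfl fun x _ => card_equation_fiber h W x, Finset.sum_add_distrib]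
  -- The summands 1 add up to the cardinality of `k`, which is zero in `k`.
  simp [add_comm]

/-- The number of points of an elliptic curve over a finite field of characteristic at least `5`,
in terms of the invariants `c₄` and `c₆`. -/
lemma card_point_eq_cubicCharSum (h6 : (6 : k) ≠ 0) (W : WeierstrassCurve k) (hΔ : W.Δ ≠ 0) :
    ((Nat.card W.toAffine.Point : ℕ) : k) = 1 + cubicCharSum W.c₄ W.c₆ := by
  have h := ringChar_ne_two_of_six_ne_zero h6
  have h36 : (36 : k) ≠ 0 := by
    rw [show (36 : k) = 6 * 6 by norm_num]; exact mul_ne_zero h6 h6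
  have h108 : (108 : k) ≠ 0 := by
    rintro h
    apply mul_ne_zero h36 h6
    linear_combination 2 * h
  rw [card_point_eq_sum h W hΔ, cubicCharSum]
  congr 1
  -- The substitution `x ↦ 36x + 3b₂` leads to the short form in `c₄, c₆`; the factor `108²` it
  -- produces is a nonzero square, invisible to the character.
  refine Fintype.sum_equiv ((Equiv.mulLeft₀ (36 : k) h36).trans (Equiv.addRight (3 * W.b₂)))
    _ _ fun x => ?_
  have : (36 * x + 3 * W.b₂) ^ 3 - 27 * W.c₄ * (36 * x + 3 * W.b₂) - 54 * W.c₆ =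
      108 ^ 2 * (4 * x ^ 3 + W.b₂ * x ^ 2 + 2 * W.b₄ * x + W.b₆) := by
    simp only [WeierstrassCurve.c₄, WeierstrassCurve.c₆]
    ring
  simp only [Equiv.trans_apply, Equiv.mulLeft₀_apply, Equiv.coe_addRight]
  rw [this, mul_pow, pow_right_comm, pow_half_card_sq h h108, one_mul]

/-- The behaviour of the character sum under a quadratic twist. -/
lemma cubicCharSum_twist {d : k} (hd : d ≠ 0) (A B : k) :
    cubicCharSum (d ^ 2 * A) (d ^ 3 * B) = (d ^ (Fintype.card k / 2)) ^ 3 * cubicCharSum A B := by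
  rw [cubicCharSum, cubicCharSum, Finset.mul_sum]
  symm
  refine Fintype.sum_equiv (Equiv.mulLeft₀ d hd) _ _ fun x => ?_
  rw [← pow_mul, mul_comm _ 3, pow_mul, ← mul_pow, Equiv.mulLeft₀_apply]
  congr 1
  ring

/-- The bound leaves `q - 1` as the only positive multiple of `q - 1`. The exponent 0 contributes `q
= 0`, because `0 ^ 0 = 1`. -/
lemma sum_pow_eq_ite {i : ℕ} (hi : i < 2 * (Fintype.card k - 1)) :
    ∑ x : k, x ^ i = if i = Fintype.card k - 1 then -1 else 0 := by
  classical
  have hq : 1 < Fintype.card k := Fintype.one_lt_card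
  rcases Nat.eq_zero_or_pos i with rfl | h0
  · rw [FiniteField.sum_pow_lt_card_sub_one k 0 (by omega), if_neg (by omega)]
  have hdvd : Fintype.card k - 1 ∣ i ↔ i = Fintype.card k - 1 := by
    refine ⟨?_, fun h => h ▸ dvd_rfl⟩
    rintro ⟨c, rfl⟩
    have h1 : c < 2 := by
      rw [mul_comm] at hi
      exact lt_of_mul_lt_mul_right hi (Nat.zero_le _)
    interval_cases c <;> simp_all
  simp_rw [← hdvd, ← FiniteField.sum_pow_units k i]
  symm
  rw [← Finset.sum_erase Finset.univ (f := fun x : k => x ^ i) (zero_pow h0.ne')]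
  refine Finset.sum_bij (fun (u : kˣ) _ => (u : k)) ?_ ?_ ?_ ?_
  · intro u _
    simp
  · intro u _ v _ h
    exact Units.ext h
  · intro x hx
    exact ⟨Units.mk0 x (Finset.ne_of_mem_erase hx), Finset.mem_univ _, rfl⟩
  · intro u _
    rfl

lemma sum_eval_eq_neg_coeff {P : k[X]} (hP : P.natDegree < 2 * (Fintype.card k - 1)) :
    ∑ x : k, P.eval x = -P.coeff (Fintype.card k - 1) := by
  simp_rw [eval_eq_sum_range' hP]
  rw [Finset.sum_comm]
  simp_rw [← Finset.mul_sum]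
  rw [Finset.sum_congr rfl fun i hi => by rw [sum_pow_eq_ite (Finset.mem_range.1 hi)]]
  have hq : 1 < Fintype.card k := Fintype.one_lt_card
  simp only [mul_ite, mul_zero, Finset.sum_ite_eq', Finset.mem_range]
  rw [if_pos (by omega), mul_neg_one]

/-- The cubic polynomial attached to the invariants `c₄ = A` and `c₆ = B`. -/
noncomputable def cubicPoly {R : Type*} [CommRing R] (A B : R) : R[X] :=
  X ^ 3 - C (27 * A) * X - C (54 * B)

lemma natDegree_cubicPoly_le {R : Type*} [CommRing R] (A B : R) :
    (cubicPoly A B).natDegree ≤ 3 := by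
  unfold cubicPoly
  compute_degree

lemma natDegree_cubicPoly_pow_le {R : Type*} [CommRing R] (A B : R) (m : ℕ) :
    (cubicPoly A B ^ m).natDegree ≤ 3 * m := by
  have := natDegree_pow_le_of_le m (natDegree_cubicPoly_le A B)
  omega

/-- The character sum is, up to sign, the Hasse invariant. -/
lemma cubicCharSum_eq_neg_coeff (h : ringChar k ≠ 2) (A B : k) :
    cubicCharSum A B =
      -(cubicPoly A B ^ (Fintype.card k / 2)).coeff (Fintype.card k - 1) := by
  have hq := card_eq_two_mul_half_add_one h
  have hq1 : 1 < Fintype.card k := Fintype.one_lt_card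
  have hdeg := natDegree_cubicPoly_pow_le A B (Fintype.card k / 2)
  rw [← sum_eval_eq_neg_coeff (by omega), cubicCharSum]
  simp [cubicPoly]

/-- The character sum over a quadratic extension is minus the square of the one over the base. -/
lemma cubicCharSum_map_of_card_eq_sq {K : Type*} [Field K] [Fintype K] (φ : k →+* K)
    (h : ringChar k ≠ 2) (hK : Fintype.card K = Fintype.card k ^ 2) (A B : k) :
    cubicCharSum (φ A) (φ B) = -φ (cubicCharSum A B) ^ 2 := by
  have hchar : ringChar K ≠ 2 := by
    intro h2
    have := FiniteField.even_card_of_char_two h2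
    rw [hK, sq, Nat.mul_mod, FiniteField.odd_card_of_char_ne_two h] at this
    omega
  obtain ⟨m, hm⟩ : ∃ m, m = Fintype.card k / 2 := ⟨_, rfl⟩
  have hq := card_eq_two_mul_half_add_one h
  have hq1 : 1 < Fintype.card k := Fintype.one_lt_card
  have hQ := card_eq_two_mul_half_add_one hchar
  set q := Fintype.card k with hqdef
  -- With `P = f ^ m`, the power of the cubic `f` upstairs is `P · P^q`, and `P^q = P(X^q)` because
  -- the coefficients lie in `k`.
  have hexp : Fintype.card K / 2 = m + m * q := by
    rw [← hm] at hq
    have : q ^ 2 = 2 * (m + m * q) + 1 := by rw [hq]; ring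
    omega
  have hmap : cubicPoly (φ A) (φ B) = (cubicPoly A B).map φ := by
    simp [cubicPoly, map_ofNat φ]
  rw [cubicCharSum_eq_neg_coeff hchar, cubicCharSum_eq_neg_coeff h, hmap, ← Polynomial.map_pow,
    coeff_map, map_neg, neg_sq, ← map_pow, hexp, hK, ← hm, pow_add, pow_mul,
    ← FiniteField.expand_card, ← hqdef]
  congr 2
  have hdeg := natDegree_cubicPoly_pow_le A B m
  set P := cubicPoly A B ^ m
  -- A contributing pair has the form `i + qc = q² - 1`, so `q ∣ i + 1`; as `i ≤ 3m < 2q - 1`, this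
  -- forces `i = c = q - 1`. Both factors are then the coefficient of `P` at `q - 1`.
  rw [coeff_mul, Finset.sum_eq_single (q - 1, q * (q - 1))]
  · rw [coeff_expand_mul' (by omega), sq]
  · rintro ⟨i, j⟩ hij hne
    rw [Finset.HasAntidiagonal.mem_antidiagonal] at hij
    simp only at hij ⊢
    by_contra hcon
    obtain ⟨hi, hj⟩ := mul_ne_zero_iff.1 hcon
    have hi' := le_natDegree_of_ne_zero hi
    rw [coeff_expand (by omega)] at hj
    split_ifs at hj with hdvd
    · obtain ⟨c, rfl⟩ := hdvd
      apply hne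
      have h1 : i + 1 + q * c = q * q := by
        have : 0 < q ^ 2 := by positivity
        rw [← sq]; omega
      have h2 : q ∣ i + 1 := by
        rw [← Nat.dvd_add_left (Dvd.intro c rfl), h1]
        exact Dvd.intro _ rfl
      obtain ⟨d, hd⟩ := h2
      have h3 : d = 1 := by
        have : d < 2 := by
          by_contra hd2
          have : q * 2 ≤ q * d := Nat.mul_le_mul_left q (by omega)
          omega
        interval_cases d <;> omega
      subst h3
      have hi1 : i = q - 1 := by omega
      have hc : q * c = q * (q - 1) := by
        rw [Nat.mul_sub]; omega
      rw [hi1, hc]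
    · exact hj rfl
  · intro hnot
    exfalso
    apply hnot
    rw [Finset.HasAntidiagonal.mem_antidiagonal]
    simp only
    rw [Nat.mul_sub, sq, mul_one]
    have : q ≤ q * q := Nat.le_mul_self q
    omega

lemma cubicCharSum_map_of_bijective {K : Type*} [Field K] [Fintype K] (φ : k →+* K)
    (hφ : Function.Bijective φ) (A B : k) :
    cubicCharSum (φ A) (φ B) = φ (cubicCharSum A B) := by
  unfold cubicCharSum
  rw [map_sum, ← Fintype.card_of_bijective hφ]
  symm
  refine Fintype.sum_bijective φ hφ _ _ fun x => ?_
  simp [map_ofNat φ]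

end FiniteField

/-! ### Minimal models over a discrete valuation ring -/

section Reduction

open WeierstrassCurve IsDiscreteValuationRing IsLocalRing

variable (R : Type*) [CommRing R] [IsDomain R] [IsDiscreteValuationRing R]
  {K : Type*} [Field K] [Algebra R K] [IsFractionRing R K]

/-- A Weierstrass curve with an integral equation of unit discriminant has good reduction, and
its minimal equation arises from the given one by a change of variables with `u` a unit. -/
lemma hasGoodReduction_minimal_and_exists_unit (W : WeierstrassCurve K) (W₀ : WeierstrassCurve R)
    (hW : W₀.map (algebraMap R K) = W) (hΔ : IsUnit W₀.Δ) :
    (W.minimal R).HasGoodReduction R ∧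
      ∃ u : Rˣ, ((W.minimal R).reduction R).c₄ = residue R u ^ 4 * residue R W₀.c₄ ∧
        ((W.minimal R).reduction R).c₆ = residue R u ^ 6 * residue R W₀.c₆ := by
  have hWint : IsIntegral R W := ⟨W₀, hW.symm⟩
  have hWΔ : W.Δ = algebraMap R K W₀.Δ := by rw [← hW, map_Δ]
  have hval : (IsDiscreteValuationRing.maximalIdeal R).valuation K W.Δ = 1 := by
    rw [hWΔ, HeightOneSpectrum.valuation_eq_one_iff_notMem]
    exact fun h => (mem_maximalIdeal _).1 h hΔ
  obtain ⟨C, hC⟩ : ∃ C : VariableChange K, W.minimal R = C • W := ⟨_, rfl⟩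
  have hmin : IsMinimal R (W.minimal R) := inferInstance
  have hgood : (W.minimal R).HasGoodReduction R := by
    refine ⟨?_⟩
    have hback : C⁻¹ • W.minimal R = W := by rw [hC, inv_smul_smul]
    -- Minimality is tested against the change of variables leading back to `W`, whose discriminant
    -- is already a unit.
    have hle := hmin.val_Δ_maximal.2 (j := C⁻¹) (by simpa only [hback] using hWint)
    simp only [hback, one_smul] at hle
    rw [← Subtype.coe_le_coe, ← Subtype.coe_le_coe, valuation_Δ_aux_eq_of_isIntegral,
      valuation_Δ_aux_eq_of_isIntegral, hval] at hle
    have h1 : (IsDiscreteValuationRing.maximalIdeal R).valuation K (W.minimal R).Δ ≤ 1 := by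
      obtain ⟨r, hr⟩ := Δ_integral_of_isIntegral R (W.minimal R)
      rw [← hr]
      exact HeightOneSpectrum.valuation_le_one _ r
    exact le_antisymm h1 (hle h1)
  refine ⟨hgood, ?_⟩
  -- Both discriminants are units and differ by `u⁻¹² `.
  have hu : (IsDiscreteValuationRing.maximalIdeal R).valuation K (C.u⁻¹ : Kˣ) = 1 := by
    have := hgood.goodReduction
    rw [hC, variableChange_Δ, map_mul, hval, mul_one, map_pow] at this
    exact (pow_eq_one_iff.1 this).resolve_right (by norm_num)
  obtain ⟨u, hu⟩ : ∃ u : Rˣ, algebraMap R K u = (C.u⁻¹ : Kˣ) := by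
    obtain ⟨r, hr⟩ := exists_lift_of_le_one hu.le
    rw [← hr, HeightOneSpectrum.valuation_eq_one_iff_notMem] at hu
    exact ⟨(not_not.1 fun h => hu ((mem_maximalIdeal _).2 h) : IsUnit r).unit, hr⟩
  have hinj := IsFractionRing.injective R K
  refine ⟨u, ?_, ?_⟩
  · rw [reduction, map_c₄, ← map_pow, ← map_mul]
    congr 1
    apply hinj
    rw [integralModel_c₄_eq, map_mul, map_pow, hu, ← map_c₄, hW, hC, variableChange_c₄]
  · rw [reduction, map_c₆, ← map_pow, ← map_mul]
    congr 1
    apply hinj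
    rw [integralModel_c₆_eq, map_mul, map_pow, hu, ← map_c₆, hW, hC, variableChange_c₆]

/-- The number of points modulo a prime of good reduction with residue characteristic at least `5`
in terms of an integral equation of unit discriminant. -/
lemma exists_card_point_reduction_eq [Fintype (ResidueField R)] (h6 : (6 : ResidueField R) ≠ 0)
    (W : WeierstrassCurve K) (W₀ : WeierstrassCurve R)
    (hW : W₀.map (algebraMap R K) = W) (hΔ : IsUnit W₀.Δ) :
    ∃ u : ResidueField R, u ≠ 0 ∧
      ((Nat.card ((W.minimal R).reduction R).toAffine.Point : ℕ) : ResidueField R) =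
        1 + cubicCharSum (u ^ 4 * residue R W₀.c₄) (u ^ 6 * residue R W₀.c₆) := by
  obtain ⟨hgood, u, h4, h6'⟩ := hasGoodReduction_minimal_and_exists_unit R W W₀ hW hΔ
  have hell := (hasGoodReduction_iff_isElliptic_reduction R).1 hgood
  refine ⟨residue R u, (residue_ne_zero_iff_isUnit _).2 u.isUnit, ?_⟩
  rw [card_point_eq_cubicCharSum h6 _ hell.isUnit.ne_zero, h4, h6']

end Reduction
-- Residue fields of number fields and of `L(√z)`
section NumberField

open IsLocalRing

variable {L : Type*} [Field L] [NumberField L]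

lemma isUnit_localRing_iff (𝔭 : HeightOneSpectrum (𝓞 L)) (x : localRing 𝔭) :
    IsUnit x ↔ 𝔭.valuation L x = 1 :=
  (Valuation.integer.integers (𝔭.valuation L)).isUnit_iff_valuation_eq_one

lemma residue_eq_zero_iff_valuation_lt_one (𝔭 : HeightOneSpectrum (𝓞 L)) (x : localRing 𝔭) :
    residue (localRing 𝔭) x = 0 ↔ 𝔭.valuation L x < 1 := by
  rw [residue_eq_zero_iff, mem_maximalIdeal, mem_nonunits_iff, isUnit_localRing_iff,
    lt_iff_le_and_ne]
  exact ⟨fun h => ⟨x.2, h⟩, fun h => h.2⟩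

lemma residue_eq_residue_iff_valuation_sub_lt_one (𝔭 : HeightOneSpectrum (𝓞 L))
    (x y : localRing 𝔭) :
    residue (localRing 𝔭) x = residue (localRing 𝔭) y ↔ 𝔭.valuation L (x - y : L) < 1 := by
  rw [← sub_eq_zero, ← map_sub, residue_eq_zero_iff_valuation_lt_one]
  rfl

/-- The reduction map from the ring of integers to the residue field at a prime. -/
noncomputable def integersToResField (𝔭 : HeightOneSpectrum (𝓞 L)) : 𝓞 L →+* resField 𝔭 :=
  (residue (localRing 𝔭)).comp
    ((algebraMap (𝓞 L) L).codRestrict (localRing 𝔭) fun x => 𝔭.valuation_le_one x)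

lemma integersToResField_apply (𝔭 : HeightOneSpectrum (𝓞 L)) (x : 𝓞 L) :
    integersToResField 𝔭 x =
      residue (localRing 𝔭) ⟨algebraMap (𝓞 L) L x, 𝔭.valuation_le_one x⟩ :=
  rfl

lemma integersToResField_eq_zero_iff (𝔭 : HeightOneSpectrum (𝓞 L)) (x : 𝓞 L) :
    integersToResField 𝔭 x = 0 ↔ x ∈ 𝔭.asIdeal := by
  rw [integersToResField_apply, residue_eq_zero_iff_valuation_lt_one,
    HeightOneSpectrum.valuation_lt_one_iff_mem]

lemma integersToResField_surjective (𝔭 : HeightOneSpectrum (𝓞 L)) :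
    Function.Surjective (integersToResField 𝔭) := by
  intro y
  obtain ⟨x, rfl⟩ := residue_surjective y
  obtain ⟨a, ha⟩ := HeightOneSpectrum.exists_valuation_sub_lt_of_integer 𝔭 x.2 1
  exact ⟨a, (residue_eq_residue_iff_valuation_sub_lt_one 𝔭 _ _).2 ha⟩

instance finite_resField (𝔭 : HeightOneSpectrum (𝓞 L)) : Finite (resField 𝔭) := by
  have : Finite (𝓞 L ⧸ 𝔭.asIdeal) := Ideal.finiteQuotientOfFreeOfNeBot _ 𝔭.ne_bot
  refine Finite.of_surjective (Ideal.Quotient.lift 𝔭.asIdeal (integersToResField 𝔭)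
    fun a ha => (integersToResField_eq_zero_iff 𝔭 a).2 ha) ?_
  exact Ideal.Quotient.lift_surjective_of_surjective _ _ (integersToResField_surjective 𝔭)

/-- This is all the trace needs of N(𝔭) modulo `p`; its equality with the cardinality of the residue
field is never used. -/
lemma absNorm_cast_resField (𝔭 : HeightOneSpectrum (𝓞 L)) :
    ((Ideal.absNorm 𝔭.asIdeal : ℕ) : resField 𝔭) = 0 := by
  rw [← map_natCast (integersToResField 𝔭), integersToResField_eq_zero_iff]
  exact Ideal.absNorm_mem _

lemma six_ne_zero_resField {𝔭 : HeightOneSpectrum (𝓞 L)}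
    (h6 : ¬ 𝔭.asIdeal ∣ Ideal.span {(6 : 𝓞 L)}) : (6 : resField 𝔭) ≠ 0 := by
  rw [← map_ofNat (integersToResField 𝔭) 6, Ne, integersToResField_eq_zero_iff]
  rwa [Ideal.dvd_span_singleton] at h6

lemma charP_resField {𝔭 : HeightOneSpectrum (𝓞 L)} {p : ℕ} (hp : p.Prime)
    (h : 𝔭.asIdeal.LiesOver (Ideal.span {(p : ℤ)})) : CharP (resField 𝔭) p := by
  have : (p : 𝓞 L) ∈ 𝔭.asIdeal := by
    have h1 : (p : ℤ) ∈ Ideal.span {(p : ℤ)} := Ideal.mem_span_singleton_self _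
    rw [h.over] at h1
    simpa [Ideal.mem_comap] using h1
  rw [← integersToResField_eq_zero_iff, map_natCast] at this
  exact (CharP.charP_iff_prime_eq_zero hp).2 this

/-- The trace in the residue field, for an integral equation of unit discriminant. -/
lemma isGoodPrime_and_exists_trace_eq (𝔭 : HeightOneSpectrum (𝓞 L)) [Fintype (resField 𝔭)]
    (h6 : (6 : resField 𝔭) ≠ 0) (W : WeierstrassCurve L) (W₀ : WeierstrassCurve (localRing 𝔭))
    (hW : W₀.map (algebraMap (localRing 𝔭) L) = W) (hΔ : 𝔭.valuation L W.Δ = 1) :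
    IsGoodPrime W 𝔭 ∧ ∃ u : resField 𝔭, u ≠ 0 ∧
      (trace W 𝔭 : resField 𝔭) =
        -cubicCharSum (u ^ 4 * residue _ W₀.c₄) (u ^ 6 * residue _ W₀.c₆) := by
  have hΔ' : IsUnit W₀.Δ := by
    rw [isUnit_localRing_iff, ← hΔ, ← hW, WeierstrassCurve.map_Δ]
    rfl
  refine ⟨(hasGoodReduction_minimal_and_exists_unit _ W W₀ hW hΔ').1, ?_⟩
  obtain ⟨u, hu, h⟩ := exists_card_point_reduction_eq _ h6 W W₀ hW hΔ'
  refine ⟨u, hu, ?_⟩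
  rw [trace]
  push_cast
  rw [h, absNorm_cast_resField]
  ring

section Extension

variable {M : Type*} [Field M] [NumberField M] [Algebra L M]

section LiesOver

variable (𝔭 : HeightOneSpectrum (𝓞 L)) (𝔓 : HeightOneSpectrum (𝓞 M))
  [h : 𝔓.asIdeal.LiesOver 𝔭.asIdeal]

lemma valuation_algebraMap_le_one {x : L} (hx : 𝔭.valuation L x ≤ 1) :
    𝔓.valuation M (algebraMap L M x) ≤ 1 := by
  rw [← HeightOneSpectrum.valuation_liesOver M 𝔭 𝔓]
  exact pow_le_one' hx _

lemma valuation_algebraMap_eq_one {x : L} (hx : 𝔭.valuation L x = 1) :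
    𝔓.valuation M (algebraMap L M x) = 1 := by
  rw [← HeightOneSpectrum.valuation_liesOver M 𝔭 𝔓, hx, one_pow]

/-- The inclusion of the valuation rings for a prime lying over another. -/
noncomputable def localRingMap : localRing 𝔭 →+* localRing 𝔓 :=
  ((algebraMap L M).comp (localRing 𝔭).subtype).codRestrict (localRing 𝔓)
    fun x => valuation_algebraMap_le_one 𝔭 𝔓 x.2

lemma coe_localRingMap (x : localRing 𝔭) :
    (localRingMap 𝔭 𝔓 x : M) = algebraMap L M x := rfl

instance isLocalHom_localRingMap : IsLocalHom (localRingMap 𝔭 𝔓) := by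
  refine ⟨fun x hx => ?_⟩
  rw [isUnit_localRing_iff, coe_localRingMap, ← HeightOneSpectrum.valuation_liesOver M 𝔭 𝔓] at hx
  rw [isUnit_localRing_iff]
  exact (pow_eq_one_iff.1 hx).resolve_right
    (Ideal.IsDedekindDomain.ramificationIdx'_ne_zero_of_liesOver 𝔓.asIdeal 𝔭.ne_bot)

/-- The embedding of residue fields for a prime lying over another. -/
noncomputable def resFieldMap : resField 𝔭 →+* resField 𝔓 :=
  ResidueField.map (localRingMap 𝔭 𝔓)

lemma resFieldMap_residue (x : localRing 𝔭) :
    resFieldMap 𝔭 𝔓 (residue _ x) = residue _ (localRingMap 𝔭 𝔓 x) := rfl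

end LiesOver

lemma exists_eq_add_mul_of_adjoin_sqrt {z : L} {s : M} (hs : s ^ 2 = algebraMap L M z)
    (hM : IntermediateField.adjoin L {s} = ⊤) (x : M) :
    ∃ a b : L, x = algebraMap L M a + algebraMap L M b * s := by
  have hint : IsIntegral L s := Algebra.IsIntegral.isIntegral s
  have hx : x ∈ IntermediateField.adjoin L {s} := hM ▸ IntermediateField.mem_top
  rw [← IntermediateField.mem_toSubalgebra,
    IntermediateField.adjoin_simple_toSubalgebra_of_isAlgebraic hint.isAlgebraic] at hx
  induction hx using Algebra.adjoin_induction with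
  | mem y hy => exact ⟨0, 1, by simp_all⟩
  | algebraMap r => exact ⟨r, 0, by simp⟩
  | add y y' _ _ hy hy' =>
    obtain ⟨a, b, rfl⟩ := hy
    obtain ⟨a', b', rfl⟩ := hy'
    exact ⟨a + a', b + b', by simp only [map_add]; ring⟩
  | mul y y' _ _ hy hy' =>
    obtain ⟨a, b, rfl⟩ := hy
    obtain ⟨a', b', rfl⟩ := hy'
    refine ⟨a * a' + b * b' * z, a * b' + b * a', ?_⟩
    simp only [map_add, map_mul, ← hs]
    ring

lemma minpoly_sqrt {z : L} {s : M} (hs : s ^ 2 = algebraMap L M z)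
    (hsL : s ∉ (algebraMap L M).range) :
    minpoly L s = Polynomial.X ^ 2 - Polynomial.C z := by
  symm
  refine minpoly.eq_of_irreducible_of_monic ?_ (by simp [hs])
    (Polynomial.monic_X_pow_sub_C z two_ne_zero)
  rw [X_pow_sub_C_irreducible_iff_of_prime Nat.prime_two]
  rintro b rfl
  rw [map_pow, sq_eq_sq_iff_eq_or_eq_neg] at hs
  rcases hs with hs | hs
  · exact hsL ⟨b, hs.symm⟩
  · exact hsL ⟨-b, by rw [map_neg, hs]⟩

lemma trace_add_mul_sqrt {z : L} {s : M} (hs : s ^ 2 = algebraMap L M z)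
    (hM : IntermediateField.adjoin L {s} = ⊤) (hsL : s ∉ (algebraMap L M).range) (a b : L) :
    Algebra.trace L M (algebraMap L M a + algebraMap L M b * s) = 2 * a := by
  have hint : IsIntegral L s := Algebra.IsIntegral.isIntegral s
  have hmin := minpoly_sqrt hs hsL
  have hrank : Module.finrank L M = 2 := by
    rw [← IntermediateField.finrank_top', ← hM, IntermediateField.adjoin.finrank hint, hmin]
    exact Polynomial.natDegree_X_pow_sub_C
  have htr : Algebra.trace L M s = 0 := by
    rw [trace_eq_finrank_mul_minpoly_nextCoeff, hmin,
      Polynomial.nextCoeff_of_natDegree_pos (by simp)]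
    simp [Polynomial.coeff_X_pow]
  rw [map_add, Algebra.trace_algebraMap, hrank, ← Algebra.smul_def, map_smul, htr]
  simp

/-- Away from `2 z`, integers of `L(√z)` have coordinates that are integral at the prime. -/
lemma exists_localRing_eq_add_mul {z : L} {s : M} (hs : s ^ 2 = algebraMap L M z)
    (hM : IntermediateField.adjoin L {s} = ⊤) (𝔭 : HeightOneSpectrum (𝓞 L))
    (hz : 𝔭.valuation L z = 1) (h2 : 𝔭.valuation L 2 = 1) (x : 𝓞 M) :
    ∃ a b : localRing 𝔭, (x : M) = algebraMap L M a + algebraMap L M b * s := by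
  have hint : ∀ y : L, IsIntegral ℤ y → 𝔭.valuation L y ≤ 1 := fun y hy =>
    𝔭.valuation_le_one (⟨y, hy⟩ : 𝓞 L)
  have hx : IsIntegral ℤ (x : M) := x.2
  obtain ⟨a, b, hab⟩ := exists_eq_add_mul_of_adjoin_sqrt hs hM (x : M)
  -- If `s` lies in `L`, the coordinates are not unique and need not be integral, so everything is
  -- moved into the first one. Otherwise `2a` and `a² - b²z` are the trace and norm of `x`.
  by_cases hsL : s ∈ (algebraMap L M).range
  · obtain ⟨t, rfl⟩ := hsL
    rw [← map_mul, ← map_add] at hab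
    rw [hab, isIntegral_algebraMap_iff (algebraMap L M).injective] at hx
    exact ⟨⟨a + b * t, hint _ hx⟩, 0, by simp [hab]⟩
  · have htr : IsIntegral ℤ (2 * a) := by
      rw [← trace_add_mul_sqrt hs hM hsL a b, ← hab]
      exact Algebra.isIntegral_trace hx
    have hnorm : IsIntegral ℤ (a ^ 2 - b ^ 2 * z) := by
      rw [← isIntegral_algebraMap_iff (algebraMap L M).injective]
      -- The norm is `x` times its conjugate, written as trace minus `x`.
      have h1 := hx.mul ((htr.map (IsScalarTower.toAlgHom ℤ L M)).sub hx)
      have h2 : (x : M) * (IsScalarTower.toAlgHom ℤ L M (2 * a) - x) =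
          algebraMap L M (a ^ 2 - b ^ 2 * z) := by
        rw [hab]
        simp only [map_sub, map_mul, map_pow, ← hs, IsScalarTower.coe_toAlgHom', map_ofNat]
        ring
      rwa [h2] at h1
    have ha : 𝔭.valuation L a ≤ 1 := by
      simpa [h2] using hint _ htr
    have hb : 𝔭.valuation L b ≤ 1 := by
      have h1 : 𝔭.valuation L (a ^ 2 - (a ^ 2 - b ^ 2 * z)) ≤ 1 :=
        (𝔭.valuation L).map_sub_le (by simpa using pow_le_one' ha 2) (hint _ hnorm)
      rw [sub_sub_cancel, map_mul, hz, mul_one, map_pow] at h1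
      exact (pow_le_one_iff two_ne_zero).1 h1
    exact ⟨⟨a, ha⟩, ⟨b, hb⟩, hab⟩

/-- The residue field of `L(√z)` at a prime not dividing `2 z` is generated by the residue of `√z`
over that of `L`. -/
lemma exists_resField_eq_add_mul {z : L} {s : M} (hs : s ^ 2 = algebraMap L M z)
    (hM : IntermediateField.adjoin L {s} = ⊤) (𝔭 : HeightOneSpectrum (𝓞 L))
    (𝔓 : HeightOneSpectrum (𝓞 M)) [𝔓.asIdeal.LiesOver 𝔭.asIdeal]
    (hz : 𝔭.valuation L z = 1) (h2 : 𝔭.valuation L 2 = 1) (σ : localRing 𝔓) (hσ : (σ : M) = s)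
    (x : resField 𝔓) :
    ∃ a b : resField 𝔭, x = resFieldMap 𝔭 𝔓 a + resFieldMap 𝔭 𝔓 b * residue _ σ := by
  obtain ⟨x, rfl⟩ := integersToResField_surjective 𝔓 x
  obtain ⟨a, b, hab⟩ := exists_localRing_eq_add_mul hs hM 𝔭 hz h2 x
  refine ⟨residue _ a, residue _ b, ?_⟩
  rw [resFieldMap_residue, resFieldMap_residue, ← map_mul, ← map_add, integersToResField_apply]
  congr 1
  ext
  simp [hab, coe_localRingMap, hσ]

end Extension

end NumberField

/-! ### Residue extension generated by a square root -/

section QuadraticExtension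

variable {k K : Type*} [Field k] [Field K] (φ : k →+* K)

lemma bijective_of_generated_by_sqrt_of_isSquare {z : k} {s : K} (hs : s ^ 2 = φ z)
    (hgen : ∀ x : K, ∃ a b : k, x = φ a + φ b * s) (hz : IsSquare z) :
    Function.Bijective φ := by
  refine ⟨φ.injective, fun x => ?_⟩
  obtain ⟨t, rfl⟩ := hz
  obtain ⟨a, b, rfl⟩ := hgen x
  rw [← sq, map_pow, sq_eq_sq_iff_eq_or_eq_neg] at hs
  rcases hs with rfl | rfl
  · exact ⟨a + b * t, by simp⟩
  · exact ⟨a - b * t, by simp [sub_eq_add_neg]⟩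

variable [Fintype K]

/-- A linear relation between 1 and `s` would put `s` in the image of `k` and make `z` a square;
hence `(1, s)` is a basis. -/
lemma card_eq_sq_of_generated_by_sqrt_of_not_isSquare [Fintype k] {z : k} {s : K} (hs : s ^ 2 = φ z)
    (hgen : ∀ x : K, ∃ a b : k, x = φ a + φ b * s) (hz : ¬ IsSquare z) :
    Fintype.card K = Fintype.card k ^ 2 := by
  have hbij : Function.Bijective fun ab : k × k => φ ab.1 + φ ab.2 * s := by
    refine ⟨?_, fun x => ?_⟩
    · rintro ⟨a, b⟩ ⟨a', b'⟩ h
      simp only at h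
      have hb : b = b' := by
        by_contra hne
        have hne' : φ (b - b') ≠ 0 := (map_ne_zero φ).2 (sub_ne_zero.2 hne)
        apply hz
        refine ⟨(a' - a) / (b - b'), φ.injective ?_⟩
        rw [← hs, ← sq, map_pow]
        congr 1
        rw [map_div₀, eq_div_iff hne', map_sub, map_sub]
        linear_combination h
      subst hb
      rw [add_left_inj] at h
      rw [φ.injective h]
    · obtain ⟨a, b, rfl⟩ := hgen x
      exact ⟨(a, b), rfl⟩
  rw [← Fintype.card_of_bijective hbij, Fintype.card_prod, sq]

open Classical in
/-- The quadratic character of the square root of a non-square, over the quadratic extension. -/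
lemma sqrt_pow_half_card_of_not_isSquare [Fintype k] (h : ringChar k ≠ 2) {z : k} {s : K} (hs : s ^ 2 = φ z)
    (hK : Fintype.card K = Fintype.card k ^ 2) (hz : ¬ IsSquare z) :
    s ^ (Fintype.card K / 2) = -φ (quadraticChar k (-1) : ℤ) := by
  obtain ⟨m, hm⟩ : ∃ m, m = Fintype.card k / 2 := ⟨_, rfl⟩
  have hq := card_eq_two_mul_half_add_one h
  -- Thus the power of `s` is `(z^m)^(m+1) = (-1)^(m+1)`, and `(-1)^m` is the character of -1.
  have hexp : Fintype.card K / 2 = 2 * ((m + 1) * m) := by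
    rw [← hm] at hq
    have : Fintype.card k ^ 2 = 2 * (2 * ((m + 1) * m)) + 1 := by rw [hq]; ring
    omega
  have hzm : z ^ m = -1 := by
    rw [hm, ← quadraticChar_eq_pow_of_char_ne_two' h, quadraticChar_neg_one_iff_not_isSquare.2 hz]
    simp
  rw [hexp, pow_mul, hs, mul_comm, pow_mul, ← map_pow, hzm, quadraticChar_eq_pow_of_char_ne_two' h,
    ← hm, ← map_pow, pow_succ, map_mul, map_neg, map_one, mul_neg_one]

/-- Over `K`, the curves with `(c₄, c₆) = (s⁻⁶, -s⁻⁸)` and `(1, -s)` are twists by `s`. -/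
lemma cubicCharSum_eq_sqrt_pow_mul (h : ringChar K ≠ 2) {z : k} {s : K} (hs : s ^ 2 = φ z)
    (hz : z ≠ 0) {u : k} {v : K} (hu : u ≠ 0) (hv : v ≠ 0) :
    cubicCharSum (φ (u ^ 4 * z⁻¹ ^ 3)) (φ (u ^ 6 * -z⁻¹ ^ 4)) =
      s ^ (Fintype.card K / 2) * cubicCharSum (v ^ 4 * 1) (v ^ 6 * -s) := by
  have hs0 : s ≠ 0 := by
    rintro rfl
    rw [zero_pow two_ne_zero] at hs
    exact hz ((map_eq_zero φ).1 hs.symm)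
  have hu0 : φ u ≠ 0 := (map_ne_zero φ).2 hu
  -- The twist is by `s⁻³`; the square factor `(u/v)²` absorbs the two rescalings without changing
  -- the character.
  have hd : (φ u / v) ^ 2 / s ^ 3 ≠ 0 := by positivity
  have h4 : φ (u ^ 4 * z⁻¹ ^ 3) = ((φ u / v) ^ 2 / s ^ 3) ^ 2 * (v ^ 4 * 1) := by
    simp only [map_mul, map_pow, map_inv₀, ← hs]
    field_simp
  have h6 : φ (u ^ 6 * -z⁻¹ ^ 4) = ((φ u / v) ^ 2 / s ^ 3) ^ 3 * (v ^ 6 * -s) := by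
    simp only [map_mul, map_pow, map_inv₀, map_neg, ← hs]
    field_simp
  rw [h4, h6, cubicCharSum_twist hd]
  congr 1
  have hs1 := pow_half_card_sq h hs0
  have hw1 := pow_half_card_sq h (div_ne_zero hu0 hv)
  rw [div_pow, pow_right_comm, hw1, pow_right_comm s]
  set ε := s ^ (Fintype.card K / 2)
  have hε : ε ≠ 0 := by positivity
  -- The twisting factor is `ε⁻⁹`, which equals `ε` since `ε² = 1`.
  have hε10 : ε ^ 10 = 1 := by
    rw [show 10 = 2 * 5 from rfl, pow_mul, hs1, one_pow]
  field_simp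
  rw [hε10]

end QuadraticExtension

/-! ### Invariants of E₀ and E₁ -/

section Curves

variable {K : Type*} [Field K]

lemma curveE₀_c₄ {z : K} (h2 : (2 : K) ≠ 0) (h3 : (3 : K) ≠ 0) : (curveE₀ z).c₄ = z⁻¹ ^ 3 := by
  have h48 : (48 : K) ≠ 0 := by
    rw [show (48 : K) = 2 ^ 4 * 3 by norm_num]; positivity
  simp only [curveE₀, WeierstrassCurve.c₄, WeierstrassCurve.b₂, WeierstrassCurve.b₄]
  field_simp
  ring

lemma curveE₀_c₆ {z : K} (h2 : (2 : K) ≠ 0) (h3 : (3 : K) ≠ 0) : (curveE₀ z).c₆ = -z⁻¹ ^ 4 := by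
  have h864 : (864 : K) ≠ 0 := by
    rw [show (864 : K) = 2 ^ 5 * 3 ^ 3 by norm_num]; positivity
  simp only [curveE₀, WeierstrassCurve.c₆, WeierstrassCurve.b₂, WeierstrassCurve.b₄,
    WeierstrassCurve.b₆]
  field_simp
  ring

lemma curveE₁_c₄ (s : K) : (curveE₁ s).c₄ = 1 := by
  simp [curveE₁, WeierstrassCurve.c₄, WeierstrassCurve.b₂, WeierstrassCurve.b₄]

lemma curveE₁_c₆ {s : K} (h2 : (2 : K) ≠ 0) (h3 : (3 : K) ≠ 0) : (curveE₁ s).c₆ = -s := by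
  have h864 : (864 : K) ≠ 0 := by
    rw [show (864 : K) = 2 ^ 5 * 3 ^ 3 by norm_num]; positivity
  simp only [curveE₁, WeierstrassCurve.c₆, WeierstrassCurve.b₂, WeierstrassCurve.b₄,
    WeierstrassCurve.b₆]
  field_simp
  ring

/-- From `1728 Δ = c₄³ - c₆² = z⁻⁹(1 - z)` and `1 - z = 1728 / j₀`. -/
lemma curveE₀_Δ [CharZero K] {j₀ : K} (hz : zZero j₀ ≠ 0) :
    (curveE₀ (zZero j₀)).Δ = (zZero j₀)⁻¹ ^ 9 * j₀⁻¹ := by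
  have h := (curveE₀ (zZero j₀)).c_relation
  rw [curveE₀_c₄ two_ne_zero three_ne_zero, curveE₀_c₆ two_ne_zero three_ne_zero] at h
  have hj : 1728 * j₀⁻¹ = 1 - zZero j₀ := by rw [zZero]; ring
  apply mul_left_cancel₀ (show (1728 : K) ≠ 0 by norm_num)
  rw [h, mul_left_comm, hj]
  field_simp

lemma curveE₁_Δ [CharZero K] {j₀ s : K} (hs : s ^ 2 = zZero j₀) :
    (curveE₁ s).Δ = j₀⁻¹ := by
  have h := (curveE₁ s).c_relation
  rw [curveE₁_c₄, curveE₁_c₆ two_ne_zero three_ne_zero] at h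
  have hj : 1728 * j₀⁻¹ = 1 - zZero j₀ := by rw [zZero]; ring
  apply mul_left_cancel₀ (show (1728 : K) ≠ 0 by norm_num)
  rw [h, hj, ← hs]
  ring

end Curves

/-! ### Good reduction of the two curves -/

section Valuation

variable {L : Type*} [Field L] [NumberField L] {𝔭 : HeightOneSpectrum (𝓞 L)}

lemma valuation_natCast_le_one (𝔭 : HeightOneSpectrum (𝓞 L)) (n : ℕ) :
    𝔭.valuation L n ≤ 1 := by
  rw [← map_natCast (algebraMap (𝓞 L) L)]
  exact 𝔭.valuation_le_one _

lemma valuation_two_three_eq_one (h6 : ¬ 𝔭.asIdeal ∣ Ideal.span {(6 : 𝓞 L)}) :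
    𝔭.valuation L 2 = 1 ∧ 𝔭.valuation L 3 = 1 := by
  have h : 𝔭.valuation L 2 * 𝔭.valuation L 3 = 1 := by
    rw [Ideal.dvd_span_singleton, ← HeightOneSpectrum.valuation_eq_one_iff_notMem (K := L)] at h6
    rw [← map_mul, ← h6, map_ofNat]
    norm_num
  have h2 : 𝔭.valuation L 2 ≤ 1 := by exact_mod_cast valuation_natCast_le_one 𝔭 2
  have h3 : 𝔭.valuation L 3 ≤ 1 := by exact_mod_cast valuation_natCast_le_one 𝔭 3
  exact ⟨eq_one_of_one_le_mul_left h2 h3 h.ge, eq_one_of_one_le_mul_right h2 h3 h.ge⟩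

/-- No zero of one factor can cancel a pole of the other: as 1728 is integral, `j₀` and `j₀ - 1728`
have their poles together. -/
lemma valuation_eq_one_of_mul_sub (j₀ : L) (hv : 𝔭.valuation L (j₀ * (j₀ - 1728)) = 1) :
    𝔭.valuation L j₀ = 1 ∧ 𝔭.valuation L (j₀ - 1728) = 1 := by
  have h1728 : 𝔭.valuation L 1728 ≤ 1 := by exact_mod_cast valuation_natCast_le_one 𝔭 1728
  rw [map_mul] at hv
  have hj : 𝔭.valuation L j₀ = 1 := by
    rcases lt_trichotomy (𝔭.valuation L j₀) 1 with h | h | h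
    · have := (𝔭.valuation L).map_sub_le h.le h1728
      exact absurd hv (mul_lt_one_of_lt_of_le h this).ne
    · exact h
    · rw [(𝔭.valuation L).map_sub_eq_of_lt_left (h1728.trans_lt h)] at hv
      exact absurd hv (one_lt_mul'' h h).ne'
  rw [hj, one_mul] at hv
  exact ⟨hj, hv⟩

lemma valuation_zZero {j₀ : L} (hj₀ : j₀ ≠ 0) (hv : 𝔭.valuation L (j₀ * (j₀ - 1728)) = 1) :
    𝔭.valuation L (zZero j₀) = 1 := by
  obtain ⟨h1, h2⟩ := valuation_eq_one_of_mul_sub j₀ hv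
  rw [zZero, show 1 - 1728 / j₀ = (j₀ - 1728) / j₀ by field_simp, map_div₀, h1, h2, div_one]

/-- Good reduction of `E₀`, and its trace in the residue field. -/
lemma curveE₀_isGoodPrime_and_exists_trace_eq [Fintype (resField 𝔭)]
    (h6 : (6 : resField 𝔭) ≠ 0) (h2 : 𝔭.valuation L 2 = 1) (h3 : 𝔭.valuation L 3 = 1)
    {j₀ : L} (hj : 𝔭.valuation L j₀ = 1) (ζ : localRing 𝔭) (hζ : (ζ : L) = zZero j₀)
    (hz : 𝔭.valuation L (zZero j₀) = 1) :
    IsGoodPrime (curveE₀ (zZero j₀)) 𝔭 ∧ ∃ u : resField 𝔭, u ≠ 0 ∧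
      (trace (curveE₀ (zZero j₀)) 𝔭 : resField 𝔭) =
        -cubicCharSum (u ^ 4 * (IsLocalRing.residue _ ζ)⁻¹ ^ 3)
          (u ^ 6 * -(IsLocalRing.residue _ ζ)⁻¹ ^ 4) := by
  have hz0 : zZero j₀ ≠ 0 := by
    intro h; rw [h, map_zero] at hz; exact zero_ne_one hz
  have h48 : 𝔭.valuation L 48 = 1 := by
    rw [show (48 : L) = 2 ^ 4 * 3 by norm_num, map_mul, map_pow, h2, h3]; simp
  have h864 : 𝔭.valuation L 864 = 1 := by
    rw [show (864 : L) = 2 ^ 5 * 3 ^ 3 by norm_num, map_mul, map_pow, map_pow, h2, h3]; simp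
  let W₀ : WeierstrassCurve (localRing 𝔭) :=
    ⟨0, 0, 0, ⟨-(1 / (48 * zZero j₀ ^ 3)), by simp [Valuation.mem_integer_iff, h48, hz]⟩,
      ⟨1 / (864 * zZero j₀ ^ 4), by simp [Valuation.mem_integer_iff, h864, hz]⟩⟩
  have hW : W₀.map (algebraMap (localRing 𝔭) L) = curveE₀ (zZero j₀) := by
    ext <;> simp [W₀, curveE₀] <;> rfl
  have hΔ : 𝔭.valuation L (curveE₀ (zZero j₀)).Δ = 1 := by
    rw [curveE₀_Δ hz0]; simp [hj, hz]
  obtain ⟨hgood, u, hu, htr⟩ := isGoodPrime_and_exists_trace_eq 𝔭 h6 _ W₀ hW hΔ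
  have hζu : IsUnit ζ := by rw [isUnit_localRing_iff, hζ, hz]
  have hζ0 : IsLocalRing.residue _ ζ ≠ 0 := (IsLocalRing.residue_ne_zero_iff_isUnit _).2 hζu
  -- The relation is cleared of denominators to hold in the local ring; inverses are taken only in
  -- the residue field.
  have hc₄ : W₀.c₄ * ζ ^ 3 = 1 := by
    ext
    have := WeierstrassCurve.map_c₄ W₀ (algebraMap (localRing 𝔭) L)
    rw [hW, curveE₀_c₄ two_ne_zero three_ne_zero] at this
    change algebraMap (localRing 𝔭) L W₀.c₄ * (ζ : L) ^ 3 = 1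
    rw [← this, hζ]
    field_simp
  have hc₆ : W₀.c₆ * ζ ^ 4 = -1 := by
    ext
    have := WeierstrassCurve.map_c₆ W₀ (algebraMap (localRing 𝔭) L)
    rw [hW, curveE₀_c₆ two_ne_zero three_ne_zero] at this
    change algebraMap (localRing 𝔭) L W₀.c₆ * (ζ : L) ^ 4 = -1
    rw [← this, hζ]
    field_simp
  refine ⟨hgood, u, hu, ?_⟩
  have hc₄' := congrArg (IsLocalRing.residue (localRing 𝔭)) hc₄
  have hc₆' := congrArg (IsLocalRing.residue (localRing 𝔭)) hc₆
  rw [map_mul, map_pow, map_one] at hc₄'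
  rw [map_mul, map_pow, map_neg, map_one] at hc₆'
  rw [htr, inv_pow, inv_pow, eq_inv_of_mul_eq_one_left hc₄',
    show -(IsLocalRing.residue _ ζ ^ 4)⁻¹ = IsLocalRing.residue _ W₀.c₆ by
      rw [← neg_one_mul, ← hc₆']; field_simp]

/-- Good reduction of `E₁`, and its trace in the residue field. -/
lemma curveE₁_isGoodPrime_and_exists_trace_eq [Fintype (resField 𝔭)]
    (h6 : (6 : resField 𝔭) ≠ 0) (h2 : 𝔭.valuation L 2 = 1) (h3 : 𝔭.valuation L 3 = 1)
    {j₀ s : L} (hj : 𝔭.valuation L j₀ = 1) (hs : s ^ 2 = zZero j₀)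
    (σ : localRing 𝔭) (hσ : (σ : L) = s) :
    IsGoodPrime (curveE₁ s) 𝔭 ∧ ∃ u : resField 𝔭, u ≠ 0 ∧
      (trace (curveE₁ s) 𝔭 : resField 𝔭) =
        -cubicCharSum (u ^ 4 * 1) (u ^ 6 * -(IsLocalRing.residue _ σ)) := by
  have h864 : 𝔭.valuation L 864 = 1 := by
    rw [show (864 : L) = 2 ^ 5 * 3 ^ 3 by norm_num, map_mul, map_pow, map_pow, h2, h3]; simp
  have hs1 : 𝔭.valuation L (1 - s) ≤ 1 :=
    (𝔭.valuation L).map_sub_le (map_one _).le (hσ ▸ σ.2)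
  let W₀ : WeierstrassCurve (localRing 𝔭) :=
    ⟨1, 0, 0, 0, ⟨-((1 - s) / 864), by simpa [Valuation.mem_integer_iff, h864] using hs1⟩⟩
  have hW : W₀.map (algebraMap (localRing 𝔭) L) = curveE₁ s := by
    ext <;> simp [W₀, curveE₁]
    rfl
  have hΔ : 𝔭.valuation L (curveE₁ s).Δ = 1 := by
    rw [curveE₁_Δ hs]; simp [hj]
  obtain ⟨hgood, u, hu, htr⟩ := isGoodPrime_and_exists_trace_eq 𝔭 h6 _ W₀ hW hΔ
  have hc₄ : W₀.c₄ = 1 := by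
    ext
    have := WeierstrassCurve.map_c₄ W₀ (algebraMap (localRing 𝔭) L)
    rw [hW, curveE₁_c₄] at this
    exact this.symm
  have hc₆ : W₀.c₆ = -σ := by
    ext
    have := WeierstrassCurve.map_c₆ W₀ (algebraMap (localRing 𝔭) L)
    rw [hW, curveE₁_c₆ two_ne_zero three_ne_zero, ← hσ] at this
    exact this.symm
  refine ⟨hgood, u, hu, ?_⟩
  rw [htr, hc₄, hc₆, map_one, map_neg]

open Classical in
lemma quadSymbol_eq_quadraticChar [Fintype (resField 𝔭)] (α : localRing 𝔭) :
    quadSymbol 𝔭 (α : L) = quadraticChar (resField 𝔭) (IsLocalRing.residue _ α) := by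
  rw [quadSymbol, dif_pos α.2, quadraticChar_apply, quadraticCharFun]
  congr

end Valuation

end TraceCongruence

open TraceCongruence IsLocalRing in
theorem corollary3p2
    {L : Type*} [Field L] [NumberField L]
    (j₀ : L) (hj₀ : j₀ ≠ 0) (hj₁ : j₀ ≠ 1728)
    -- `M = L(√z₀)`, with `s = √z₀` either of the two square roots
    {M : Type*} [Field M] [NumberField M] [Algebra L M]
    (s : M) (hs : s ^ 2 = algebraMap L M (TraceCongruence.zZero j₀))
    (hM : IntermediateField.adjoin L {s} = ⊤)
    -- a prime `𝔭` of `L` with `𝔭 ∤ 6` and `v_𝔭(j₀ (j₀ - 1728)) = 0`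
    (𝔭 : HeightOneSpectrum (𝓞 L))
    (h6 : ¬ 𝔭.asIdeal ∣ Ideal.span {(6 : 𝓞 L)})
    (hv : 𝔭.valuation L (j₀ * (j₀ - 1728)) = 1)
    -- a prime `𝔓` of `M` above `𝔭`, and the rational prime `p` below `𝔭`
    (𝔓 : HeightOneSpectrum (𝓞 M)) (h𝔓 : 𝔓.asIdeal.LiesOver 𝔭.asIdeal)
    (p : ℕ) (hp : p.Prime) (hp𝔭 : 𝔭.asIdeal.LiesOver (Ideal.span {(p : ℤ)})) :
    TraceCongruence.IsGoodPrime (TraceCongruence.curveE₀ (TraceCongruence.zZero j₀)) 𝔭 ∧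
    TraceCongruence.IsGoodPrime (TraceCongruence.curveE₁ s) 𝔓 ∧
    (TraceCongruence.quadSymbol 𝔭 (TraceCongruence.zZero j₀) = 1 →
      TraceCongruence.trace (TraceCongruence.curveE₀ (TraceCongruence.zZero j₀)) 𝔭 ^ 2 ≡
        TraceCongruence.trace (TraceCongruence.curveE₁ s) 𝔓 ^ 2 [ZMOD (p : ℤ)]) ∧
    (TraceCongruence.quadSymbol 𝔭 (TraceCongruence.zZero j₀) = -1 →
      TraceCongruence.trace (TraceCongruence.curveE₀ (TraceCongruence.zZero j₀)) 𝔭 ^ 2 ≡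
        -TraceCongruence.quadSymbol 𝔭 (-1) *
          TraceCongruence.trace (TraceCongruence.curveE₁ s) 𝔓 [ZMOD (p : ℤ)]) := by
  classical
  have : Fintype (resField 𝔭) := Fintype.ofFinite _
  have : Fintype (resField 𝔓) := Fintype.ofFinite _
  have hk6 := six_ne_zero_resField h6
  set φ := resFieldMap 𝔭 𝔓
  have hK6 : (6 : resField 𝔓) ≠ 0 := by
    rw [← map_ofNat φ 6]
    exact (map_ne_zero φ).2 hk6
  have hk := ringChar_ne_two_of_six_ne_zero hk6
  have hK := ringChar_ne_two_of_six_ne_zero hK6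
  have : CharP (resField 𝔭) p := charP_resField hp hp𝔭
  have : CharP (resField 𝔓) p := charP_of_injective_ringHom φ.injective p
  obtain ⟨h2, h3⟩ := valuation_two_three_eq_one h6
  have hj := (valuation_eq_one_of_mul_sub j₀ hv).1
  have hz := valuation_zZero hj₀ hv
  have hσ1 : 𝔓.valuation M s = 1 := by
    have := valuation_algebraMap_eq_one 𝔭 𝔓 hz
    rw [← hs, map_pow] at this
    exact (pow_eq_one_iff.1 this).resolve_right two_ne_zero
  let ζ : localRing 𝔭 := ⟨zZero j₀, hz.le⟩
  let σ : localRing 𝔓 := ⟨s, hσ1.le⟩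
  have hζ0 : residue (localRing 𝔭) ζ ≠ 0 :=
    (residue_ne_zero_iff_isUnit _).2 ((isUnit_localRing_iff 𝔭 ζ).2 hz)
  have hs' : residue (localRing 𝔓) σ ^ 2 = φ (residue _ ζ) := by
    rw [resFieldMap_residue, ← map_pow]
    congr 1
    ext
    exact hs
  have hgen := exists_resField_eq_add_mul hs hM 𝔭 𝔓 hz h2 σ rfl
  obtain ⟨hgood₀, u, hu, htr₀⟩ :=
    curveE₀_isGoodPrime_and_exists_trace_eq hk6 h2 h3 hj ζ rfl hz
  have hzM : s ^ 2 = zZero (algebraMap L M j₀) := by rw [hs]; simp [zZero, map_ofNat (algebraMap L M)]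
  obtain ⟨hgood₁, v, hv, htr₁⟩ :=
    curveE₁_isGoodPrime_and_exists_trace_eq (𝔭 := 𝔓) hK6
      (by simpa only [map_ofNat] using valuation_algebraMap_eq_one 𝔭 𝔓 h2)
      (by simpa only [map_ofNat] using valuation_algebraMap_eq_one 𝔭 𝔓 h3)
      (valuation_algebraMap_eq_one 𝔭 𝔓 hj) hzM σ rfl
  have htwist := cubicCharSum_eq_sqrt_pow_mul φ hK hs' hζ0 hu hv
  have hε := pow_half_card_sq hK (d := residue (localRing 𝔓) σ)
    ((residue_ne_zero_iff_isUnit _).2 ((isUnit_localRing_iff 𝔓 σ).2 hσ1))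
  have htr₀' := congrArg φ htr₀
  rw [map_intCast, map_neg] at htr₀'
  have hsymb := quadSymbol_eq_quadraticChar ζ
  refine ⟨hgood₀, hgood₁, fun h => ?_, fun h => ?_⟩
  -- Congruence mod `p` is equality in the residue field at 𝔓, where both traces can be compared.
  · rw [← CharP.intCast_eq_intCast (resField 𝔓) p]
    rw [show zZero j₀ = ζ from rfl, hsymb, quadraticChar_one_iff_isSquare hζ0] at h
    have hbij := bijective_of_generated_by_sqrt_of_isSquare φ hs' hgen h
    rw [cubicCharSum_map_of_bijective φ hbij] at htwist
    push_cast
    rw [htr₀', htr₁, htwist, neg_sq, neg_sq, mul_pow, hε, one_mul]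
  · rw [← CharP.intCast_eq_intCast (resField 𝔓) p]
    rw [show zZero j₀ = ζ from rfl, hsymb, quadraticChar_neg_one_iff_not_isSquare] at h
    have hcard := card_eq_sq_of_generated_by_sqrt_of_not_isSquare φ hs' hgen h
    rw [cubicCharSum_map_of_card_eq_sq φ hk hcard,
      sqrt_pow_half_card_of_not_isSquare φ hk hs' hcard h, map_intCast] at htwist
    have hneg := quadSymbol_eq_quadraticChar (-1 : localRing 𝔭)
    rw [map_neg, map_one] at hneg
    change quadSymbol 𝔭 (-1) = _ at hneg
    push_cast
    rw [hneg, htr₀', htr₁, neg_sq]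
    linear_combination -htwist
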